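/- Let $G=(V,E)$ be a finite directed acyclic multigraph with unit-capacity edges, with distinct sources $s_1,s_2$ (no incoming edges) and distinct terminals $t_1,t_2$ (no outgoing edges), $\{s_1,s_2\}\cap\{t_1,t_2\}=\emptyset$. For $A,B\subseteq\{1,2\}$ let $k_{A-B}$ be the minimum number of edges whose removal destroys all directed paths from $\{s_i:i\in A\}$ to $\{t_j:j\in B\}$; write $k_{1-2}=k_{\{1\}-\{2\}}$, $k_{12-1}=k_{\{1,2\}-\{1\}}$, etc. A linear network code over a finite field $\mathbb F$ at integer rates $(R_1,R_2)$, $R_i\ge 0$, consists of encoding matrices $M_i$ (with $R_i$ columns), which map the message $X_i\in\mathbb F^{R_i}$ to the symbols on the outgoing edges of $s_i$, and of local coding coefficients $f_{m,e}\in\mathbb F$: the signal on an edge $e$ that leaves a node other than $s_1,s_2$ is $Y_e=\sum_{m:\,\mathrm{head}(m)=\mathrm{tail}(e)}f_{m,e}Y_m$. The pair $(R_1,R_2)$ is achievable over $\mathbb F$ if for some such code each $t_i$ can recover $X_i$ from the signals on its incoming edges, whatever the messages are. For given local coding coefficients let $H_{ij}$ be the transfer matrix from the outgoing edges of $s_j$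 to the incoming edges of $t_i$. Put $R_1^*=\min(k_{1-2},k_{1-1})$ and $R_2^*=\min\bigl(k_{2-1},k_{2-2},\min(k_{12-1},k_{12-2})-R_1^*\bigr)$ (the boundary point $Q_1$ of the base region). A code at $Q_1$ consists of local coding coefficients over a finite field $\mathbb F$ with $\mathrm{rank}(H_{ij})=k_{j-i}$ and $\mathrm{rank}([H_{i1}\ H_{i2}])=k_{12-i}$ for all $i,j\in\{1,2\}$, together with encoding matrices $M_1,M_2$ with $R_1^*$ and $R_2^*$ columns such that $\mathrm{rank}(M_i)=R_i^*$ and $\mathrm{rank}([H_{i1}M_1\ H_{i2}M_2])=R_1^*+R_2^*$ for $i=1,2$ (so both terminals can decode both sources). Theorem (Region 2, high interference). Suppose $k_{1-2}+k_{2-1}\ge\min(k_{12-1},k_{12-2})$ and $k_{1-2}\le k_{1-1}$. Then a code at $Q_1$ exists over some finite field. Moreover, for every finite field $\mathbb F$ and every code at $Q_1$ over $\mathbb F$, with transfer matrices $H_{ij}$ and encoding matrices $M_1,M_2$, every pair of non-negative integers $(R_1,R_2)$ with $$R_1\le k_{1-1},\qquad R_2\le\min(k_{12-1},k_{12-2})-k_{1-2},\qquad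 R_1+R_2\le\mathrm{rank}([H_{11}\ H_{12}M_2])$$ is achievable over $\mathbb F$. -/

import Mathlib

open scoped Matrix

noncomputable section

/-- A two-unicast network: a directed acyclic multigraph with vertices `V` and unit-capacity
edges `E`, sources `s 0, s 1` without incoming edges and terminals `t 0, t 1` without outgoing
edges. Session `i` goes from `s i` to `t i`. -/
structure TwoUnicastNetwork (V E : Type*) where
  tail : E → V
  head : E → V
  s : Fin 2 → V
  t : Fin 2 → V
  acyclic : ∀ v, ¬ Relation.TransGen (fun u w => ∃ e, tail e = u ∧ head e = w) v v
  s_injective : Function.Injective s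
  t_injective : Function.Injective t
  s_ne_t : ∀ i j, s i ≠ t j
  no_in : ∀ e i, head e ≠ s i
  no_out : ∀ e i, tail e ≠ t i

namespace TwoUnicastNetwork

variable {V E : Type*} (N : TwoUnicastNetwork V E)

/-- `F` is a cut between the sources in `A` and the terminals in `B`: no directed path from such
a source to such a terminal avoids the edges of `F`. -/
def IsCut (A B : Finset (Fin 2)) (F : Finset E) : Prop :=
  ∀ i ∈ A, ∀ j ∈ B,
    ¬ Relation.ReflTransGen (fun u w => ∃ e, e ∉ F ∧ N.tail e = u ∧ N.head e = w) (N.s i) (N.t j)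

/-- The minimum cut `k_{A-B}` between the sources in `A` and the terminals in `B`. -/
def k (A B : Finset (Fin 2)) : ℕ :=
  sInf {n | ∃ F : Finset E, N.IsCut A B F ∧ F.card = n}

/-- The outgoing edges of source `i`. -/
abbrev Out (i : Fin 2) : Type _ := {e : E // N.tail e = N.s i}

/-- The incoming edges of terminal `i`. -/
abbrev In (i : Fin 2) : Type _ := {e : E // N.head e = N.t i}

instance [Fintype E] (i : Fin 2) : Fintype (N.Out i) := Fintype.ofFinite _

theorem wf [Finite V] :
    WellFounded (fun m e : E => ∃ e', N.tail e' = N.tail m ∧ N.head e' = N.tail e) := by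
  have : Std.Irrefl (Relation.TransGen fun u w => ∃ e, N.tail e = u ∧ N.head e = w) :=
    ⟨N.acyclic⟩
  have h : WellFounded (Relation.TransGen fun u w => ∃ e, N.tail e = u ∧ N.head e = w) :=
    Finite.wellFounded_of_trans_of_irrefl _
  exact Subrelation.wf (fun {_ _} h => Relation.TransGen.single h) (InvImage.wf N.tail h)

variable {K : Type*} [Field K] [Finite V] [Fintype E]

open Classical in
/-- The signals on all edges, for local coding coefficients `f m e` (from edge `m` to edge `e`),
when the sources put the symbols `u` on their outgoing edges. -/
def signal (f : E → E → K) (u : E → K) : E → K :=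
  N.wf.fix fun e ih =>
    if ∃ i, N.tail e = N.s i then u e
    else ∑ m : {m // N.head m = N.tail e}, f m e * ih m ⟨m, rfl, m.2⟩

open Classical in
theorem signal_eq (f : E → E → K) (u : E → K) (e : E) :
    N.signal f u e = if ∃ i, N.tail e = N.s i then u e
      else ∑ m : {m // N.head m = N.tail e}, f m e * N.signal f u m := by
  rw [signal, WellFounded.fix_eq]

open Classical in
/-- The transfer matrix `H i j` from the outgoing edges of source `j` to the incoming edges of
terminal `i`. -/
def H (f : E → E → K) (i j : Fin 2) : Matrix (N.In i) (N.Out j) K :=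
  Matrix.of fun e' e => N.signal f (Pi.single e.1 1) e'.1

open Classical in
/-- The symbols on the outgoing edges of the sources, for encoding matrices `M i` and
messages `x i`. -/
def encode {R : Fin 2 → ℕ} (M : ∀ i, Matrix (N.Out i) (Fin (R i)) K)
    (x : ∀ i, Fin (R i) → K) : E → K :=
  fun e => ∑ i, if h : N.tail e = N.s i then (M i *ᵥ x i) ⟨e, h⟩ else 0

variable (K) in
/-- The rate pair `(R 0, R 1)` is achieved by a linear network code over `K`: each terminal `i`
recovers the message `x i` of its source from the signals on its incoming edges. -/
def Achievable (R : Fin 2 → ℕ) : Prop :=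
  ∃ (f : E → E → K) (M : ∀ i, Matrix (N.Out i) (Fin (R i)) K),
    ∀ i, ∃ D : (N.In i → K) → (Fin (R i) → K),
      ∀ x : ∀ j, Fin (R j) → K, D (fun e => N.signal f (N.encode M x) e.1) = x i

/-- The local coding coefficients `f` make all transfer matrices of maximum rank. -/
structure HasMaxRank (f : E → E → K) : Prop where
  single : ∀ i j, (N.H f i j).rank = N.k {j} {i}
  both : ∀ i, (Matrix.fromCols (N.H f i 0) (N.H f i 1)).rank = N.k {0, 1} {i}

/-- The smaller one of the cut values `k_{12-1}` and `k_{12-2}`. -/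
def kMin : ℕ := min (N.k {0, 1} {0}) (N.k {0, 1} {1})

/-- The rate pair `(R₁*, R₂*)` at the boundary point `Q₁` of the base region. -/
def rateQ₁ : Fin 2 → ℕ :=
  ![min (N.k {0} {1}) (N.k {0} {0}),
    min (min (N.k {1} {0}) (N.k {1} {1})) (N.kMin - min (N.k {0} {1}) (N.k {0} {0}))]

/-- `f` and `M` are local coding coefficients of maximum rank and full-rank encoding matrices that
multicast both sources to both terminals at the rates of `Q₁`. -/
structure IsCodeAtQ₁ (f : E → E → K) (M : ∀ i, Matrix (N.Out i) (Fin (N.rateQ₁ i)) K) :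
    Prop where
  maxRank : N.HasMaxRank f
  encoding : ∀ i, (M i).rank = N.rateQ₁ i
  multicast : ∀ i, (Matrix.fromCols (N.H f i 0 * M 0) (N.H f i 1 * M 1)).rank =
    N.rateQ₁ 0 + N.rateQ₁ 1

end TwoUnicastNetwork

end

/-! ### Subspace avoidance and greedy precoding. -/

section LinearAlgebra

open Module Submodule

/-! Achievability: a code at `Q₁` has `R₁* = k_{1-2} = rank H₂₁`, so the column space of `H₂₁M₁` is
already that of `H₂₁`. Since terminal 2 separates `H₂₁M₁` from `H₂₂M₂`, it separates all possible
interference of source 1 from `H₂₂M₂`. Thus `M₁` may be replaced by any matrix and `M₂` by `M₂Q`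
with `Q` of full column rank. Only terminal 1 still constrains the choice, and
`exists_rank_fromCols_mul` supplies the matrices over the given field, however small.

Existence: over a large field the coefficients are chosen edge by edge in topological order, each
coding vector avoiding every span of earlier ones that it is not forced into
(`exists_forall_genericAt`). Then dimensions of spans of coding vectors equal minimum cuts, for all
source sets at once (`finrank_span_edgeVec_inFinset`), and greedy precoding for both terminals
simultaneously gives `M₁`, `M₂`. -/

/-- Over a finite field with more than `card ι` elements, some vector lies in none of the proper
subspaces among the `p i`. -/
theorem exists_mem_imp_eq_top_of_card_lt {K X ι : Type*} [Field K] [Finite K] [AddCommGroup X]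
    [Module K X] [FiniteDimensional K X] [Fintype ι] (hc : Fintype.card ι < Nat.card K)
    (p : ι → Submodule K X) : ∃ x, ∀ i, x ∈ p i → p i = ⊤ := by
  classical
  by_contra! hcon
  have : Finite X := Module.finite_of_finite K
  have := Fintype.ofFinite X
  -- A proper subspace fills at most a fraction `1 / |K|` of `X`, so fewer than `|K|` of them cannot
  -- cover `X`.
  have hcard (i : ι) (hi : p i ≠ ⊤) : Nat.card K * Nat.card (p i) ≤ Nat.card X := by
    have hlt := Submodule.finrank_lt hi
    rw [Module.natCard_eq_pow_finrank (K := K) (V := p i),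
      Module.natCard_eq_pow_finrank (K := K) (V := X), ← pow_succ']
    exact Nat.pow_le_pow_right Nat.card_pos hlt
  have hcover : (Finset.univ : Finset X) ⊆
      (Finset.univ.filter fun i => p i ≠ ⊤).biUnion fun i =>
        Finset.univ.filter fun x => x ∈ p i := by
    intro x _
    obtain ⟨i, hi, hne⟩ := hcon x
    simp only [Finset.mem_biUnion, Finset.mem_filter, Finset.mem_univ, true_and]
    exact ⟨i, hne, hi⟩
  have h1 := (Finset.card_le_card hcover).trans Finset.card_biUnion_le
  have h2 : Nat.card K * Nat.card X ≤ Fintype.card ι * Nat.card X := by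
    calc Nat.card K * Nat.card X
        ≤ ∑ i with p i ≠ ⊤, Nat.card K * Nat.card (p i) := by
          rw [← Finset.mul_sum]
          refine Nat.mul_le_mul_left _ ?_
          rw [Nat.card_eq_fintype_card]
          refine h1.trans (Finset.sum_le_sum fun i _ => ?_)
          rw [Nat.card_eq_fintype_card, ← Fintype.card_subtype]
      _ ≤ ∑ i with p i ≠ ⊤, Nat.card X :=
          Finset.sum_le_sum fun i hi => hcard i (Finset.mem_filter.1 hi).2
      _ ≤ Fintype.card ι * Nat.card X := by
          rw [Finset.sum_const, smul_eq_mul]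
          exact Nat.mul_le_mul_right _ (Finset.card_le_univ _)
  exact absurd (Nat.le_of_mul_le_mul_right h2 Nat.card_pos) (by omega)

/-- Given `ι`-indexed families `p ≤ q` of subspaces of `X`, some vector lies in none of the proper
subspaces among the `p i` and `q i`. -/
def AvoidsPairs (K X ι : Type*) [Field K] [AddCommGroup X] [Module K X] : Prop :=
  ∀ p q : ι → Submodule K X, p ≤ q → ∃ x, ∀ i, (x ∈ p i → p i = ⊤) ∧ (x ∈ q i → q i = ⊤)

/-- For one nested pair, avoiding the larger proper member avoids both, so no bound on the size of
the field is needed. This lets the second claim hold over the field of the given code. -/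
theorem avoidsPairs_of_unique (K X ι : Type*) [Field K] [AddCommGroup X] [Module K X]
    [Unique ι] : AvoidsPairs K X ι := by
  intro p q hpq
  have h (r : Submodule K X) : ∃ x, x ∈ r → r = ⊤ := by
    by_contra! hr
    exact (hr 0).2 (eq_top_iff'.2 fun x => (hr x).1)
  by_cases hq : q default = ⊤
  · obtain ⟨x, hx⟩ := h (p default)
    refine ⟨x, fun i => ?_⟩
    rw [Unique.eq_default i]
    exact ⟨hx, fun _ => hq⟩
  · obtain ⟨x, hx⟩ := h (q default)
    refine ⟨x, fun i => ?_⟩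
    rw [Unique.eq_default i]
    exact ⟨fun hp => absurd (hx (hpq default hp)) hq, hx⟩

theorem avoidsPairs_of_card_lt {K X ι : Type*} [Field K] [Finite K] [AddCommGroup X]
    [Module K X] [FiniteDimensional K X] [Fintype ι] (hc : 2 * Fintype.card ι < Nat.card K) :
    AvoidsPairs K X ι := by
  intro p q _
  obtain ⟨x, hx⟩ := exists_mem_imp_eq_top_of_card_lt (K := K)
    (by simpa [two_mul] using hc) (Sum.elim p q)
  exact ⟨x, fun i => ⟨hx (Sum.inl i), hx (Sum.inr i)⟩⟩

variable {K : Type*} [Field K] {X Y ι : Type*} [AddCommGroup X] [Module K X]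
  [AddCommGroup Y] [Module K Y] {W : ι → Type*} [∀ i, AddCommGroup (W i)] [∀ i, Module K (W i)]
  [∀ i, FiniteDimensional K (W i)]

/-- Either the image of `x` is new and the dimension grows, or the preimage is all of `X` and the
range of `h` is already exhausted. -/
theorem min_finrank_sup_map_step {W : Type*} [AddCommGroup W] [Module K W]
    [FiniteDimensional K W] (h : X →ₗ[K] W) (C : Submodule K W) (U : Submodule K X) (n : ℕ) {x : X}
    (hU : min (finrank K C + n) (finrank K ↥(C ⊔ LinearMap.range h)) ≤ finrank K ↥(C ⊔ U.map h))
    (hx : x ∈ (C ⊔ U.map h).comap h → (C ⊔ U.map h).comap h = ⊤) :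
    min (finrank K C + (n + 1)) (finrank K ↥(C ⊔ LinearMap.range h)) ≤
      finrank K ↥(C ⊔ (span K {x} ⊔ U).map h) := by
  have hle : C ⊔ U.map h ≤ C ⊔ (span K {x} ⊔ U).map h :=
    sup_le_sup_left (map_mono le_sup_right) _
  by_cases hmem : x ∈ (C ⊔ U.map h).comap h
  · have htop := hx hmem
    have : C ⊔ LinearMap.range h ≤ C ⊔ U.map h := by
      refine sup_le le_sup_left ?_
      rw [LinearMap.range_eq_map, map_le_iff_le_comap, htop]
    exact (min_le_right _ _).trans (finrank_mono (this.trans hle))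
  · have hlt : C ⊔ U.map h < C ⊔ (span K {x} ⊔ U).map h := by
      refine lt_of_le_of_ne hle fun heq => hmem ?_
      rw [mem_comap, heq]
      exact mem_sup_right (mem_map_of_mem (mem_sup_left (mem_span_singleton_self x)))
    have := finrank_lt_finrank_of_lt hlt
    omega

/-- Greedy choice of `n` vectors of `X` whose images add as many dimensions as possible both to the
subspaces `C i` and to the subspaces `D i`. -/
theorem AvoidsPairs.exists_finrank_sup_map (hav : AvoidsPairs K X ι) (h : ∀ i, X →ₗ[K] W i)
    (C D : ∀ i, Submodule K (W i)) (hCD : ∀ i, C i ≤ D i) (n : ℕ) :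
    ∃ M : Fin n → X, ∀ i,
      min (finrank K (C i) + n) (finrank K ↥(C i ⊔ LinearMap.range (h i))) ≤
        finrank K ↥(C i ⊔ (span K (Set.range M)).map (h i)) ∧
      min (finrank K (D i) + n) (finrank K ↥(D i ⊔ LinearMap.range (h i))) ≤
        finrank K ↥(D i ⊔ (span K (Set.range M)).map (h i)) := by
  induction n with
  | zero => exact ⟨Fin.elim0, fun i => ⟨(min_le_left _ _).trans (finrank_mono le_sup_left),
      (min_le_left _ _).trans (finrank_mono le_sup_left)⟩⟩
  | succ n ih =>
    obtain ⟨M, hM⟩ := ih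
    obtain ⟨x, hx⟩ := hav (fun i => (C i ⊔ (span K (Set.range M)).map (h i)).comap (h i))
      (fun i => (D i ⊔ (span K (Set.range M)).map (h i)).comap (h i))
      fun i => comap_mono (sup_le_sup_right (hCD i) _)
    refine ⟨Fin.cons x M, fun i => ?_⟩
    rw [Fin.range_cons, span_insert]
    exact ⟨min_finrank_sup_map_step _ _ _ _ (hM i).1 (hx i).1,
      min_finrank_sup_map_step _ _ _ _ (hM i).2 (hx i).2⟩

/-- Vectors of `X` and of `Y` whose images in every `W i` are jointly independent. -/
theorem exists_finrank_map_sup_map (hX : AvoidsPairs K X ι) (hY : AvoidsPairs K Y ι)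
    (h : ∀ i, X →ₗ[K] W i) (g : ∀ i, Y →ₗ[K] W i) (a b : ℕ)
    (ha : ∀ i, a ≤ finrank K (LinearMap.range (h i)))
    (hb : ∀ i, b ≤ finrank K (LinearMap.range (g i)))
    (hab : ∀ i, a + b ≤ finrank K ↥(LinearMap.range (h i) ⊔ LinearMap.range (g i))) :
    ∃ (M : Fin a → X) (P : Fin b → Y), ∀ i,
      a + b ≤ finrank K ↥((span K (Set.range M)).map (h i) ⊔ (span K (Set.range P)).map (g i)) := by
  -- Starting from `⊥` makes the images of `M` independent; starting from the range of `g` keeps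
  -- enough room to add the `b` images of `P` afterwards.
  obtain ⟨M, hM⟩ := hX.exists_finrank_sup_map h (fun _ => ⊥) (fun i => LinearMap.range (g i))
    (fun _ => bot_le) a
  obtain ⟨P, hP⟩ := hY.exists_finrank_sup_map g (fun i => (span K (Set.range M)).map (h i)) _
    (fun _ => le_rfl) b
  refine ⟨M, P, fun i => le_trans ?_ (hP i).1⟩
  obtain ⟨h1, h2⟩ := hM i
  rw [bot_sup_eq, bot_sup_eq, finrank_bot, zero_add] at h1
  rw [sup_comm (LinearMap.range (g i)), sup_comm (LinearMap.range (g i))] at h2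
  have := ha i
  have := hb i
  have := hab i
  omega

theorem finrank_eq_and_disjoint_of_add_le_finrank_sup {W : Type*} [AddCommGroup W] [Module K W]
    [FiniteDimensional K W] {A B : Submodule K W} {a b : ℕ} (hA : finrank K A ≤ a)
    (hB : finrank K B ≤ b) (hab : a + b ≤ finrank K ↥(A ⊔ B)) :
    finrank K A = a ∧ finrank K B = b ∧ Disjoint A B := by
  have := Submodule.finrank_sup_add_finrank_inf_eq A B
  refine ⟨by omega, by omega, ?_⟩
  rw [disjoint_iff, ← Submodule.finrank_eq_zero (R := K)]
  omega

end LinearAlgebra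

/-! ### Ranks and column spaces of block matrices. -/

namespace Matrix

open _root_.Module

variable {K : Type*} [Field K] {m n n' : Type*} [Fintype n] [Fintype n']

theorem range_mulVecLin_fromCols (A : Matrix m n K) (B : Matrix m n' K) :
    LinearMap.range (fromCols A B).mulVecLin =
      LinearMap.range A.mulVecLin ⊔ LinearMap.range B.mulVecLin := by
  rw [range_mulVecLin, range_mulVecLin, range_mulVecLin, ← Submodule.span_union]
  congr 1
  ext v
  simp only [Set.mem_range, Set.mem_union, Sum.exists]
  exact Iff.rfl

theorem rank_fromCols (A : Matrix m n K) (B : Matrix m n' K) :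
    (fromCols A B).rank =
      finrank K ↥(LinearMap.range A.mulVecLin ⊔ LinearMap.range B.mulVecLin) := by
  rw [rank, range_mulVecLin_fromCols]

theorem range_mulVecLin_mul (A : Matrix m n K) (B : Matrix n n' K) :
    LinearMap.range (A * B).mulVecLin = (LinearMap.range B.mulVecLin).map A.mulVecLin := by
  rw [mulVecLin_mul, LinearMap.range_comp]

theorem injective_mulVec_of_rank_eq {A : Matrix m n K} (h : A.rank = Fintype.card n) :
    Function.Injective A.mulVec := by
  have := A.mulVecLin.finrank_range_add_finrank_ker
  rw [← rank, h, finrank_fintype_fun_eq_card, Nat.add_eq_left, Submodule.finrank_eq_zero] at this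
  exact LinearMap.ker_eq_bot.1 this

end Matrix

namespace Matrix

open _root_.Module

variable {K : Type*} [Field K] {ι n n' : Type*} [Fintype n] [Fintype n'] {m : ι → Type*}
  [∀ i, Finite (m i)]

/-- If every `[H i, G i]` has large enough rank, then `H i` and `G i` can be precoded, by
matrices independent of `i`, so that all column spaces become independent and of full dimension. -/
theorem exists_rank_fromCols_mul (hn : AvoidsPairs K (n → K) ι) (hn' : AvoidsPairs K (n' → K) ι)
    (H : ∀ i, Matrix (m i) n K) (G : ∀ i, Matrix (m i) n' K) (a b : ℕ)
    (ha : ∀ i, a ≤ (H i).rank) (hb : ∀ i, b ≤ (G i).rank)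
    (hab : ∀ i, a + b ≤ (fromCols (H i) (G i)).rank) :
    ∃ (M : Matrix n (Fin a) K) (P : Matrix n' (Fin b) K), ∀ i,
      (fromCols (H i * M) (G i * P)).rank = a + b := by
  simp only [rank_fromCols] at hab
  obtain ⟨M, P, hMP⟩ := exists_finrank_map_sup_map hn hn' (fun i => (H i).mulVecLin)
    (fun i => (G i).mulVecLin) a b ha hb hab
  refine ⟨of fun e k => M k e, of fun e k => P k e, fun i => le_antisymm ?_ ?_⟩
  · simpa using rank_le_card_width (fromCols (H i * of fun e k => M k e) (G i * of fun e k => P k e))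
  · rw [rank_fromCols, range_mulVecLin_mul, range_mulVecLin_mul, range_mulVecLin, range_mulVecLin]
    exact hMP i

theorem rank_eq_and_disjoint_of_rank_fromCols {m : Type*} [Finite m] {a b : ℕ}
    {A : Matrix m (Fin a) K} {B : Matrix m (Fin b) K} (h : (fromCols A B).rank = a + b) :
    A.rank = a ∧ B.rank = b ∧
      Disjoint (LinearMap.range A.mulVecLin) (LinearMap.range B.mulVecLin) :=
  finrank_eq_and_disjoint_of_add_le_finrank_sup
    (A.rank_le_card_width.trans_eq (Fintype.card_fin a))
    (B.rank_le_card_width.trans_eq (Fintype.card_fin b))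
    (by rw [← h, rank_fromCols])

end Matrix

/-! ### Linearity of the network and achievability beyond `Q₁`. -/

namespace TwoUnicastNetwork

theorem rateQ₁_zero {V E : Type*} {N : TwoUnicastNetwork V E}
    (hCut : N.k {0} {1} ≤ N.k {0} {0}) : N.rateQ₁ 0 = N.k {0} {1} :=
  min_eq_left hCut

variable {V E : Type*} (N : TwoUnicastNetwork V E) {K : Type*} [Field K] [Finite V] [Fintype E]

open Classical in
theorem eq_signal (f : E → E → K) (u y : E → K)
    (hy : ∀ e, y e = if ∃ i, N.tail e = N.s i then u e
      else ∑ m : {m // N.head m = N.tail e}, f m e * y m) : y = N.signal f u := by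
  funext e
  induction e using N.wf.induction with
  | _ e ih =>
    rw [hy, N.signal_eq]
    split_ifs
    · rfl
    · exact Finset.sum_congr rfl fun m _ => by rw [ih m ⟨m, rfl, m.2⟩]

-- Superposition: the combination of unit responses solves the recursion that determines the signal
-- uniquely.
open Classical in
theorem signal_eq_sum (f : E → E → K) (u : E → K) (e : E) :
    N.signal f u e = ∑ d, u d * N.signal f (Pi.single d 1) e := by
  refine (congrFun (N.eq_signal f u (fun e => ∑ d, u d * N.signal f (Pi.single d 1) e)
    fun e => ?_) e).symm
  split_ifs with h
  · rw [Finset.sum_eq_single e]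
    · rw [N.signal_eq, if_pos h, Pi.single_eq_same, mul_one]
    · intro d _ hd
      rw [N.signal_eq, if_pos h, Pi.single_eq_of_ne hd.symm, mul_zero]
    · simp
  · simp_rw [N.signal_eq f _ e, if_neg h, Finset.mul_sum]
    rw [Finset.sum_comm]
    exact Finset.sum_congr rfl fun m _ => Finset.sum_congr rfl fun d _ => by ring

theorem signal_encode (f : E → E → K) {R : Fin 2 → ℕ}
    (M : ∀ i, Matrix (N.Out i) (Fin (R i)) K) (x : ∀ i, Fin (R i) → K) (i : Fin 2) :
    (fun e : N.In i => N.signal f (N.encode M x) e.1) = ∑ j, N.H f i j *ᵥ (M j *ᵥ x j) := by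
  classical
  funext e
  rw [signal_eq_sum, Finset.sum_apply]
  simp only [encode, Finset.sum_mul]
  rw [Finset.sum_comm]
  refine Finset.sum_congr rfl fun j _ => ?_
  simp only [Matrix.mulVec, dotProduct, H, Matrix.of_apply]
  refine (Fintype.sum_of_injective Subtype.val Subtype.val_injective _ _ (fun d hd => ?_)
    fun d => ?_).symm
  · rw [dif_neg fun h => hd ⟨⟨d, h⟩, rfl⟩, zero_mul]
  · rw [dif_pos d.2, mul_comm]

/-- By linearity, a trivial kernel in the component `x i` means that the received signal determines
`x i`; the decoder inverts the signal map on its image. -/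
theorem achievable_of_forall (f : E → E → K) {R : Fin 2 → ℕ}
    (M : ∀ i, Matrix (N.Out i) (Fin (R i)) K)
    (h : ∀ i, ∀ x : ∀ j, Fin (R j) → K, ∑ j, N.H f i j *ᵥ (M j *ᵥ x j) = 0 → x i = 0) :
    N.Achievable K R := by
  refine ⟨f, M, fun i => ⟨Function.extend (fun x : ∀ j, Fin (R j) → K =>
    fun e : N.In i => N.signal f (N.encode M x) e.1) (fun x => x i) 0, fun x => ?_⟩⟩
  refine Function.FactorsThrough.extend_apply (fun x y hxy => ?_) _ x
  simp only [signal_encode] at hxy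
  refine sub_eq_zero.1 (h i (x - y) ?_)
  simp only [Pi.sub_apply, Matrix.mulVec_sub, Finset.sum_sub_distrib, hxy, sub_self]

section

variable {N} {f : E → E → K}

/-- Inequalities between cuts are read off the ranks that realize them, which avoids arguing with
cuts. -/
theorem HasMaxRank.k_le_both (hf : N.HasMaxRank f) (i : Fin 2) :
    N.k {0} {i} ≤ N.k {0, 1} {i} := by
  rw [← hf.single, ← hf.both, Matrix.rank_fromCols]
  exact Submodule.finrank_mono le_sup_left

theorem HasMaxRank.k_both_le (hf : N.HasMaxRank f) (i : Fin 2) :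
    N.k {0, 1} {i} ≤ N.k {0} {i} + N.k {1} {i} := by
  rw [← hf.single, ← hf.single, ← hf.both, Matrix.rank_fromCols]
  exact Submodule.finrank_add_le_finrank_add_finrank _ _

/-- High interference makes the bound `k_{2-1}` redundant, and `k_{12-2} ≤ k_{1-2} + k_{2-2}` does
the same for `k_{2-2}`. -/
theorem HasMaxRank.rateQ₁_one (hf : N.HasMaxRank f)
    (hInterference : N.kMin ≤ N.k {0} {1} + N.k {1} {0})
    (hCut : N.k {0} {1} ≤ N.k {0} {0}) : N.rateQ₁ 1 = N.kMin - N.k {0} {1} := by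
  have h1 : N.rateQ₁ 1 = min (min (N.k {1} {0}) (N.k {1} {1}))
    (N.kMin - min (N.k {0} {1}) (N.k {0} {0})) := rfl
  have h2 := hf.k_both_le 1
  have h3 : N.kMin ≤ N.k {0, 1} {1} := min_le_right _ _
  omega

theorem HasMaxRank.k_le_kMin (hf : N.HasMaxRank f) (hCut : N.k {0} {1} ≤ N.k {0} {0}) :
    N.k {0} {1} ≤ N.kMin :=
  le_min (hCut.trans (hf.k_le_both 0)) (hf.k_le_both 1)

/-- The rates beyond `Q₁`: terminal `1` sees the interference of source `0` inside a space that is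
independent of its own signal, whatever source `0` sends. -/
theorem IsCodeAtQ₁.achievable {M : ∀ i, Matrix (N.Out i) (Fin (N.rateQ₁ i)) K}
    (hM : N.IsCodeAtQ₁ f M) (hInterference : N.kMin ≤ N.k {0} {1} + N.k {1} {0})
    (hCut : N.k {0} {1} ≤ N.k {0} {0}) {R₁ R₂ : ℕ} (h₁ : R₁ ≤ N.k {0} {0})
    (h₂ : R₂ ≤ N.kMin - N.k {0} {1})
    (h₁₂ : R₁ + R₂ ≤ (Matrix.fromCols (N.H f 0 0) (N.H f 0 1 * M 1)).rank) :
    N.Achievable K ![R₁, R₂] := by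
  obtain ⟨-, hB₀, -⟩ := Matrix.rank_eq_and_disjoint_of_rank_fromCols (hM.multicast 0)
  obtain ⟨hA₁, hB₁, hdisj⟩ := Matrix.rank_eq_and_disjoint_of_rank_fromCols (hM.multicast 1)
  -- The key point: `M 0` already exhausts the interference at terminal `1`.
  have hrange : LinearMap.range (N.H f 1 0 * M 0).mulVecLin =
      LinearMap.range (N.H f 1 0).mulVecLin := by
    refine Submodule.eq_of_le_of_finrank_eq ?_ ?_
    · rw [Matrix.range_mulVecLin_mul]
      exact LinearMap.map_le_range
    · exact hA₁.trans ((rateQ₁_zero hCut).trans (hM.maxRank.single 1 0).symm)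
  rw [hrange] at hdisj
  obtain ⟨M₀, Q, hMQ⟩ := Matrix.exists_rank_fromCols_mul (ι := Unit)
    (avoidsPairs_of_unique K _ _) (avoidsPairs_of_unique K _ _) (fun _ => N.H f 0 0)
    (fun _ => N.H f 0 1 * M 1) R₁ R₂ (fun _ => h₁.trans_eq (hM.maxRank.single 0 0).symm)
    (fun _ => by rw [hB₀, hM.maxRank.rateQ₁_one hInterference hCut]; exact h₂) fun _ => h₁₂
  obtain ⟨hA', hB', hdisj'⟩ := Matrix.rank_eq_and_disjoint_of_rank_fromCols (hMQ ())
  have hQ : Q.rank = R₂ :=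
    le_antisymm (by simpa using Q.rank_le_card_width) (hB'.symm.trans_le (Matrix.rank_mul_le_right _ _))
  let M' : ∀ i, Matrix (N.Out i) (Fin (![R₁, R₂] i)) K
    | 0 => M₀
    | 1 => M 1 * Q
  refine N.achievable_of_forall f M' fun i x hx => ?_
  -- The messages are renamed at the types `Fin R₁ → K` and `Fin R₂ → K`, which agree with the
  -- original ones only up to unfolding `![R₁, R₂]`.
  obtain ⟨x₀, hx₀⟩ : ∃ x₀ : Fin R₁ → K, x₀ = x 0 := ⟨_, rfl⟩
  obtain ⟨x₁, hx₁⟩ : ∃ x₁ : Fin R₂ → K, x₁ = x 1 := ⟨_, rfl⟩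
  have hsum : N.H f i 0 *ᵥ (M₀ *ᵥ x₀) = N.H f i 1 *ᵥ (M 1 *ᵥ (Q *ᵥ -x₁)) := by
    rw [Fin.sum_univ_two, add_eq_zero_iff_eq_neg, ← Matrix.mulVec_neg, ← Matrix.mulVec_neg] at hx
    rw [Matrix.mulVec_mulVec (-x₁), hx₀, hx₁]
    exact hx
  match i with
  | 0 =>
    have h0 : (N.H f 0 0 * M₀) *ᵥ x₀ = 0 := by
      refine (Submodule.disjoint_def.1 hdisj') _ ⟨x₀, rfl⟩ ⟨-x₁, ?_⟩
      simp only [Matrix.mulVecLin_apply, ← Matrix.mulVec_mulVec, hsum]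
    exact hx₀.symm.trans (Matrix.injective_mulVec_of_rank_eq (by simpa using hA')
      (h0.trans (Matrix.mulVec_zero _).symm))
  | 1 =>
    have h0 : (N.H f 1 1 * M 1) *ᵥ (Q *ᵥ -x₁) = 0 := by
      refine (Submodule.disjoint_def.1 hdisj) _ ⟨M₀ *ᵥ x₀, ?_⟩ ⟨Q *ᵥ -x₁, rfl⟩
      simp only [Matrix.mulVecLin_apply, ← Matrix.mulVec_mulVec, hsum]
    have h1 := Matrix.injective_mulVec_of_rank_eq (by simpa using hB₁)
      (h0.trans (Matrix.mulVec_zero _).symm)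
    have h2 := Matrix.injective_mulVec_of_rank_eq (by simpa using hQ)
      (h1.trans (Matrix.mulVec_zero _).symm)
    exact hx₁.symm.trans (neg_eq_zero.1 h2)

end

end TwoUnicastNetwork

/-! ### Topological order and blocking sets of edges. -/

namespace TwoUnicastNetwork

section Order

variable {V E : Type*} (N : TwoUnicastNetwork V E) [Finite V] [Fintype E]

/-- A topological numbering of the edges. -/
theorem exists_topological_numbering : ∃ ord : E → ℕ, Function.Injective ord ∧
    ∀ m e, N.head m = N.tail e → ord m < ord e := by
  classical
  -- An edge is numbered by its count of predecessors in a linear extension of the adjacency order.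
  obtain ⟨s, hrs, hs⟩ := @IsWellFounded.exists_well_order_ge _ _ ⟨N.wf⟩
  have hlt : ∀ a b, s a b →
      (Finset.univ.filter (s · a)).card < (Finset.univ.filter (s · b)).card := by
    intro a b hab
    refine Finset.card_lt_card (Finset.ssubset_iff_of_subset ?_ |>.2 ⟨a, by simpa, ?_⟩)
    · intro c hc
      simp only [Finset.mem_filter, Finset.mem_univ, true_and] at hc ⊢
      exact _root_.trans hc hab
    · simp only [Finset.mem_filter, Finset.mem_univ, true_and]
      exact irrefl a
  refine ⟨fun e => (Finset.univ.filter (s · e)).card, fun a b hab => ?_, fun m e h =>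
    hlt m e (hrs _ _ ⟨m, rfl, h⟩)⟩
  rcases trichotomous_of s a b with h | h | h
  · exact absurd hab (hlt a b h).ne
  · exact h
  · exact absurd hab (hlt b a h).ne'

end Order

section Blocks

variable {V E : Type*} (N : TwoUnicastNetwork V E)

/-- `v` can be reached from `u` along edges outside `F`. -/
def ReachAvoiding (F : Finset E) : V → V → Prop :=
  Relation.ReflTransGen fun u w => ∃ e, e ∉ F ∧ N.tail e = u ∧ N.head e = w

/-- Every path from a source in `A` that ends with an edge of `T` uses an edge of `F`. -/
def Blocks (A : Finset (Fin 2)) (T F : Finset E) : Prop :=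
  ∀ e ∈ T, e ∉ F → ∀ i ∈ A, ¬ N.ReachAvoiding F (N.s i) (N.tail e)

variable {N}

theorem ReachAvoiding.step {F : Finset E} {u : V} {m : E} (h : N.ReachAvoiding F u (N.tail m))
    (hm : m ∉ F) : N.ReachAvoiding F u (N.head m) :=
  h.tail ⟨m, hm, rfl, rfl⟩

theorem ReachAvoiding.exists_edge {F : Finset E} {u v : V} (h : N.ReachAvoiding F u v)
    (hne : u ≠ v) : ∃ m, m ∉ F ∧ N.head m = v ∧ N.ReachAvoiding F u (N.tail m) := by
  rcases Relation.ReflTransGen.cases_tail h with rfl | ⟨w, hw, m, hm, rfl, hmv⟩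
  · exact absurd rfl hne
  · exact ⟨m, hm, hmv, hw⟩

theorem isCut_of_blocks {A : Finset (Fin 2)} {j : Fin 2} {T F : Finset E}
    (hT : ∀ e, N.head e = N.t j → e ∈ T) (h : N.Blocks A T F) : N.IsCut A {j} F := by
  intro i hi j' hj' hreach
  obtain rfl := Finset.mem_singleton.1 hj'
  obtain ⟨m, hmF, hm, hreach⟩ := ReachAvoiding.exists_edge hreach (N.s_ne_t i j')
  exact h m (hT m hm) hmF i hi hreach

theorem blocks_of_isCut {A : Finset (Fin 2)} {j : Fin 2} {T F : Finset E}
    (hT : ∀ e ∈ T, N.head e = N.t j) (h : N.IsCut A {j} F) : N.Blocks A T F := by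
  intro e he heF i hi hreach
  exact h i hi j (Finset.mem_singleton_self j) (hT e he ▸ hreach.step heF)

theorem Blocks.mono {A : Finset (Fin 2)} {T T' F F' : Finset E} (h : N.Blocks A T F)
    (hT : T' ⊆ T) (hF : F ⊆ F') : N.Blocks A T' F' := fun e he heF i hi hreach =>
  h e (hT he) (fun h => heF (hF h)) i hi
    (Relation.ReflTransGen.mono (fun _ _ ⟨d, hd, h⟩ => ⟨d, fun h => hd (hF h), h⟩) _ _ hreach)

end Blocks

/-! ### Generic coding vectors: dimension equals blocking number. -/

section EdgeVec

variable {V E : Type*} (N : TwoUnicastNetwork V E) {K : Type*} [Field K] [Finite V] [Fintype E]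

open Classical in
/-- The global coding vector of the edge `e`, restricted to the outgoing edges of the sources
in `A`. -/
noncomputable def edgeVec (f : E → E → K) (A : Finset (Fin 2)) (e : E) : E → K := fun d =>
  if ∃ i ∈ A, N.tail d = N.s i then N.signal f (Pi.single d 1) e else 0

open Classical in
theorem edgeVec_of_mem (f : E → E → K) {A : Finset (Fin 2)} {e : E}
    (he : ∃ i ∈ A, N.tail e = N.s i) : N.edgeVec f A e = Pi.single e 1 := by
  have he' : ∃ i, N.tail e = N.s i := he.imp fun _ h => h.2
  funext d
  rw [edgeVec, N.signal_eq, if_pos he']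
  rcases eq_or_ne d e with rfl | hd
  · rw [if_pos he]
  · rw [Pi.single_eq_of_ne hd, Pi.single_eq_of_ne hd.symm, ite_self]

theorem edgeVec_of_notMem (f : E → E → K) {A : Finset (Fin 2)} {e : E}
    (he : ∃ i, N.tail e = N.s i) (hA : ¬ ∃ i ∈ A, N.tail e = N.s i) : N.edgeVec f A e = 0 := by
  classical
  funext d
  rw [edgeVec, N.signal_eq, if_pos he]
  split_ifs with hd
  · rw [Pi.single_eq_of_ne]
    · rfl
    · rintro rfl
      exact hA hd
  · rfl

open Classical in
theorem edgeVec_of_not_source (f : E → E → K) (A : Finset (Fin 2)) {e : E}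
    (he : ¬ ∃ i, N.tail e = N.s i) : N.edgeVec f A e =
      ∑ m : {m // N.head m = N.tail e}, f m e • N.edgeVec f A m := by
  funext d
  simp only [edgeVec, Finset.sum_apply, Pi.smul_apply, smul_eq_mul, N.signal_eq f _ e, if_neg he]
  split_ifs with hd
  · rfl
  · simp

/-- Unrolling the recursion backwards from `e` stops at edges of `F` or at source edges outside `F`;
the latter do not leave a source in `A`, so their restricted vectors vanish. -/
theorem edgeVec_mem_span (f : E → E → K) {A : Finset (Fin 2)} {F : Finset E} (e : E)
    (he : N.Blocks A {e} F) :
    N.edgeVec f A e ∈ Submodule.span K (N.edgeVec f A '' F) := by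
  classical
  induction e using N.wf.induction with
  | _ e ih =>
    by_cases heF : e ∈ F
    · exact Submodule.subset_span ⟨e, heF, rfl⟩
    have he := he e (Finset.mem_singleton_self e) heF
    by_cases hs : ∃ i, N.tail e = N.s i
    · rw [N.edgeVec_of_notMem f hs]
      · exact zero_mem _
      · rintro ⟨i, hi, his⟩
        exact he i hi (his ▸ Relation.ReflTransGen.refl)
    · rw [N.edgeVec_of_not_source f A hs]
      refine sum_mem fun m _ => Submodule.smul_mem _ _ (ih m ⟨m, rfl, m.2⟩ ?_)
      intro d hd hdF i hi hreach
      obtain rfl := Finset.mem_singleton.1 hd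
      exact he i hi (m.2 ▸ hreach.step hdF)

theorem finrank_span_edgeVec_le (f : E → E → K) {A : Finset (Fin 2)} {T F : Finset E}
    (h : N.Blocks A T F) :
    Module.finrank K (Submodule.span K (N.edgeVec f A '' T)) ≤ F.card := by
  classical
  calc Module.finrank K (Submodule.span K (N.edgeVec f A '' T))
      ≤ Module.finrank K (Submodule.span K (N.edgeVec f A '' F)) := by
        refine Submodule.finrank_mono (Submodule.span_le.2 ?_)
        rintro _ ⟨e, he, rfl⟩
        exact N.edgeVec_mem_span f e (h.mono (Finset.singleton_subset_iff.2 he) subset_rfl)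
    _ ≤ F.card := by
        rw [← Finset.coe_image]
        exact (finrank_span_finset_le_card _).trans Finset.card_image_le

variable {ord : E → ℕ}

open Classical in
theorem signal_single_eq_zero (hord : ∀ m e, N.head m = N.tail e → ord m < ord e)
    (f : E → E → K) (d e : E) (hde : ord e < ord d) : N.signal f (Pi.single d 1) e = 0 := by
  induction e using N.wf.induction with
  | _ e ih =>
    rw [N.signal_eq]
    split_ifs
    · exact Pi.single_eq_of_ne (by rintro rfl; exact hde.false) _
    · exact Finset.sum_eq_zero fun m _ => by
        rw [ih m ⟨m, rfl, m.2⟩ ((hord m e m.2).trans hde), mul_zero]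

/-- Causality: later coefficients do not disturb earlier signals, so coefficients can be fixed one
edge at a time. -/
theorem signal_congr (hord : ∀ m e, N.head m = N.tail e → ord m < ord e)
    {f f' : E → E → K} (u : E → K) (e : E) (hf : ∀ m d, ord d ≤ ord e → f m d = f' m d) :
    N.signal f u e = N.signal f' u e := by
  classical
  induction e using N.wf.induction with
  | _ e ih =>
    rw [N.signal_eq, N.signal_eq]
    split_ifs
    · rfl
    · refine Finset.sum_congr rfl fun m _ => ?_
      rw [hf m e le_rfl, ih m ⟨m, rfl, m.2⟩ fun m' d hd => hf m' d (hd.trans (hord m e m.2).le)]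

theorem edgeVec_congr (hord : ∀ m e, N.head m = N.tail e → ord m < ord e)
    {f f' : E → E → K} (A : Finset (Fin 2)) (e : E)
    (hf : ∀ m d, ord d ≤ ord e → f m d = f' m d) : N.edgeVec f A e = N.edgeVec f' A e := by
  funext d
  rw [edgeVec, edgeVec, N.signal_congr hord _ e hf]

/-- The coding vector of `e` lies in the span of coding vectors of earlier edges only if this is
so for all edges that enter the tail of `e`. -/
def GenericAt (ord : E → ℕ) (f : E → E → K) (e : E) : Prop :=
  ∀ (A : Finset (Fin 2)) (T : Finset E), (∀ d ∈ T, ord d < ord e) →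
    (¬ ∃ i, N.tail e = N.s i) →
    N.edgeVec f A e ∈ Submodule.span K (N.edgeVec f A '' T) →
    ∀ m, N.head m = N.tail e → N.edgeVec f A m ∈ Submodule.span K (N.edgeVec f A '' T)

variable {N} in
theorem GenericAt.congr (hord : ∀ m e, N.head m = N.tail e → ord m < ord e)
    {f f' : E → E → K} {e : E} (hf : ∀ m d, ord d ≤ ord e → f m d = f' m d)
    (h : N.GenericAt ord f e) : N.GenericAt ord f' e := by
  intro A T hT hs hmem m hm
  have himage : N.edgeVec f' A '' T = N.edgeVec f A '' T := Set.image_congr fun d hd =>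
    (N.edgeVec_congr hord A d fun m d' hd' => hf m d' (hd'.trans (hT d hd).le)).symm
  rw [himage, ← N.edgeVec_congr hord A e hf] at hmem
  rw [himage, ← N.edgeVec_congr hord A m fun m' d hd => hf m' d (hd.trans (hord m e hm).le)]
  exact h A T hT hs hmem m hm

/-- The vector of `e` is linear in the coefficients `c` entering `e`, so for each `(A, T)` the bad
`c` form a subspace. It is everything only if each unit `c`, that is, each entering vector, lands in
the span. A large field allows all proper bad subspaces to be avoided at once. -/
theorem exists_update_genericAt [Finite K]
    (hcard : Fintype.card (Finset (Fin 2) × Finset E) < Nat.card K)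
    (hord : ∀ m e, N.head m = N.tail e → ord m < ord e)
    (f : E → E → K) (e : E) :
    ∃ f' : E → E → K, (∀ m d, d ≠ e → f' m d = f m d) ∧ N.GenericAt ord f' e := by
  classical
  let L (A : Finset (Fin 2)) : (E → K) →ₗ[K] (E → K) :=
    ∑ m : {m // N.head m = N.tail e}, (LinearMap.proj m.1).smulRight (N.edgeVec f A m)
  have hL (A : Finset (Fin 2)) (c : E → K) :
      L A c = ∑ m : {m // N.head m = N.tail e}, c m • N.edgeVec f A m := by
    simp [L]
  obtain ⟨c, hc⟩ := exists_mem_imp_eq_top_of_card_lt hcard fun q =>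
    (Submodule.span K (N.edgeVec f q.1 '' q.2)).comap (L q.1)
  refine ⟨fun m d => if d = e then c m else f m d, fun m d hd => if_neg hd, ?_⟩
  intro A T hT hs hmem m hm
  have hvec (d : E) (hd : ord d < ord e) :
      N.edgeVec (fun m d => if d = e then c m else f m d) A d = N.edgeVec f A d := by
    refine N.edgeVec_congr hord A d fun m d' hd' => if_neg ?_
    rintro rfl
    omega
  have himage : N.edgeVec (fun m d => if d = e then c m else f m d) A '' T =
      N.edgeVec f A '' T := Set.image_congr fun d hd => hvec d (hT d hd)
  rw [himage] at hmem
  rw [himage, hvec m (hord m e hm)]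
  have htop := hc (A, T) (by
    rw [Submodule.mem_comap, hL]
    convert hmem using 1
    rw [N.edgeVec_of_not_source _ A hs]
    refine Finset.sum_congr rfl fun m _ => ?_
    rw [if_pos rfl, hvec m (hord m e m.2)])
  have hm' : Pi.single m 1 ∈ (Submodule.span K (N.edgeVec f A '' T)).comap (L A) := by
    rw [htop]
    trivial
  rw [Submodule.mem_comap, hL, Finset.sum_eq_single ⟨m, hm⟩] at hm'
  · simpa using hm'
  · intro d _ hd
    rw [Pi.single_eq_of_ne (fun h => hd (Subtype.ext h)), zero_smul]
  · simp

theorem exists_forall_genericAt [Finite K]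
    (hcard : Fintype.card (Finset (Fin 2) × Finset E) < Nat.card K)
    (hord : ∀ m e, N.head m = N.tail e → ord m < ord e) (hinj : Function.Injective ord) :
    ∃ f : E → E → K, ∀ e, N.GenericAt ord f e := by
  classical
  suffices ∀ S : Finset E, ∃ f : E → E → K, ∀ e ∈ S, N.GenericAt ord f e by
    obtain ⟨f, hf⟩ := this Finset.univ
    exact ⟨f, fun e => hf e (Finset.mem_univ e)⟩
  intro S
  -- Edges are added in increasing order, so the update at `a` leaves the earlier ones generic.
  induction S using Finset.induction_on_max_value ord with
  | empty => exact ⟨0, by simp⟩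
  | insert a S ha hmax ih =>
    obtain ⟨f, hf⟩ := ih
    obtain ⟨f', hf', hgen⟩ := N.exists_update_genericAt hcard hord f a
    refine ⟨f', fun e he => ?_⟩
    rcases Finset.mem_insert.1 he with rfl | heS
    · exact hgen
    · refine (hf e heS).congr hord fun m d hd => (hf' m d ?_).symm
      rintro rfl
      exact ha (hinj (le_antisymm hd (hmax e heS)) ▸ heS)

/-- For generic local coding coefficients, the dimension spanned by the coding vectors of a set of
edges is the minimum size of a set of edges that blocks it. -/
theorem exists_blocks_card_le (hord : ∀ m e, N.head m = N.tail e → ord m < ord e)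
    (hinj : Function.Injective ord) {f : E → E → K} (hf : ∀ e, N.GenericAt ord f e)
    (A : Finset (Fin 2)) (T : Finset E) : ∃ F : Finset E, N.Blocks A T F ∧
      F.card ≤ Module.finrank K (Submodule.span K (N.edgeVec f A '' T)) := by
  classical
  suffices ∀ (n : ℕ) (T : Finset E), (∀ d ∈ T, ord d < n) → ∃ F : Finset E, N.Blocks A T F ∧
      F.card ≤ Module.finrank K (Submodule.span K (N.edgeVec f A '' T)) by
    refine this (T.sup ord + 1) T fun d hd => Nat.lt_succ_of_le (Finset.le_sup hd)
  intro n
  induction n with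
  | zero =>
    intro T hT
    exact ⟨∅, fun e he => absurd (hT e he) (Nat.not_lt_zero _), by simp⟩
  | succ n ih =>
    intro T hT
    by_cases hn : ∃ e ∈ T, ord e = n
    swap
    · exact ih T fun d hd => lt_of_le_of_ne (Nat.le_of_lt_succ (hT d hd)) fun h => hn ⟨d, hd, h⟩
    obtain ⟨e, heT, rfl⟩ := hn
    have hlt : ∀ d ∈ T.erase e, ord d < ord e := fun d hd =>
      lt_of_le_of_ne (Nat.le_of_lt_succ (hT d (Finset.mem_of_mem_erase hd))) fun h =>
        Finset.ne_of_mem_erase hd (hinj h)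
    have hspan : Submodule.span K (N.edgeVec f A '' T.erase e) ≤
        Submodule.span K (N.edgeVec f A '' T) :=
      Submodule.span_mono (Set.image_mono (Finset.coe_subset.2 (Finset.erase_subset e T)))
    -- If the last edge `e` is redundant, genericity allows it to be replaced by the edges entering
    -- its tail without enlarging the span; otherwise `e` joins `F` and pays for itself with one
    -- dimension.
    by_cases hmem : N.edgeVec f A e ∈ Submodule.span K (N.edgeVec f A '' T.erase e)
    · have heA : ¬ ∃ i ∈ A, N.tail e = N.s i := by
        intro h
        -- By causality all earlier vectors vanish in coordinate `e`, where the vector of a source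
        -- edge of `A` is `1`.
        have hzero : Submodule.span K (N.edgeVec f A '' T.erase e) ≤
            LinearMap.ker (LinearMap.proj e : (E → K) →ₗ[K] K) := by
          refine Submodule.span_le.2 ?_
          rintro _ ⟨d, hd, rfl⟩
          change N.edgeVec f A d e = 0
          rw [edgeVec, N.signal_single_eq_zero hord f e d (hlt d hd), ite_self]
        have h1 : N.edgeVec f A e e = 0 := hzero hmem
        rw [N.edgeVec_of_mem f h, Pi.single_eq_same] at h1
        exact one_ne_zero h1
      let P := Finset.univ.filter fun m => N.head m = N.tail e
      obtain ⟨F, hF, hcard⟩ := ih (T.erase e ∪ P) fun d hd => by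
        rcases Finset.mem_union.1 hd with hd | hd
        · exact hlt d hd
        · exact hord d e (Finset.mem_filter.1 hd).2
      refine ⟨F, fun d hd hdF i hi hreach => ?_, hcard.trans (Submodule.finrank_mono ?_)⟩
      · rcases eq_or_ne d e with rfl | hne
        · obtain ⟨m, hmF, hm, hreach⟩ := hreach.exists_edge fun h => heA ⟨i, hi, h.symm⟩
          exact hF m (Finset.mem_union_right _ (by simpa [P] using hm)) hmF i hi hreach
        · exact hF d (Finset.mem_union_left _ (Finset.mem_erase.2 ⟨hne, hd⟩)) hdF i hi hreach
      · refine le_trans (Submodule.span_le.2 ?_) hspan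
        rintro _ ⟨d, hd, rfl⟩
        rcases Finset.mem_union.1 (Finset.mem_coe.1 hd) with hd | hd
        · exact Submodule.subset_span ⟨d, hd, rfl⟩
        · have hd := (Finset.mem_filter.1 hd).2
          refine hf e A _ hlt ?_ hmem d hd
          rintro ⟨i, hi⟩
          exact N.no_in d i (hd.trans hi)
    · obtain ⟨F, hF, hcard⟩ := ih (T.erase e) hlt
      refine ⟨insert e F, fun d hd hdF => ?_, ?_⟩
      · refine hF.mono subset_rfl (Finset.subset_insert e F) d (Finset.mem_erase.2 ⟨?_, hd⟩) hdF
        rintro rfl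
        exact hdF (Finset.mem_insert_self _ _)
      · have hlt' := Submodule.finrank_lt_finrank_of_lt (lt_of_le_of_ne hspan fun h =>
          hmem (h ▸ Submodule.subset_span ⟨e, heT, rfl⟩))
        exact (Finset.card_insert_le e F).trans (by omega)

end EdgeVec

end TwoUnicastNetwork

/-! ### Transfer matrices of maximum rank and codes at `Q₁`. -/

namespace TwoUnicastNetwork

section InFinset

variable {V E : Type*} (N : TwoUnicastNetwork V E) [Fintype E]

open Classical in
/-- The incoming edges of terminal `i`, as a finite set. -/
noncomputable def inFinset (i : Fin 2) : Finset E := Finset.univ.filter fun e => N.head e = N.t i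

theorem mem_inFinset {i : Fin 2} {e : E} : e ∈ N.inFinset i ↔ N.head e = N.t i := by
  simp [inFinset]

end InFinset

section MaxRank

variable {V E : Type*} (N : TwoUnicastNetwork V E) {K : Type*} [Field K] [Finite V] [Fintype E]

/-- Extension by zero along `g` is injective and turns the rows of `B` into coding vectors, so this
is row rank. A general `g` covers one source and both sources. -/
theorem rank_eq_finrank_span_edgeVec (f : E → E → K) (A : Finset (Fin 2)) (i : Fin 2) {n : Type*}
    [Fintype n] {g : n → E} (hg : Function.Injective g)
    (hA : ∀ d, (∃ j ∈ A, N.tail d = N.s j) → d ∈ Set.range g) (B : Matrix (N.In i) n K)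
    (hB : ∀ e c, B e c = N.edgeVec f A e.1 (g c)) :
    B.rank = Module.finrank K (Submodule.span K (N.edgeVec f A '' N.inFinset i)) := by
  have hext (e : N.In i) : Function.ExtendByZero.linearMap K g (B.row e) = N.edgeVec f A e.1 := by
    funext d
    change Function.extend g (B.row e) 0 d = _
    by_cases hd : d ∈ Set.range g
    · obtain ⟨c, rfl⟩ := hd
      rw [hg.extend_apply]
      exact hB e c
    · rw [Function.extend_apply' _ _ _ hd, edgeVec, if_neg fun h => hd (hA d h)]
      rfl
  have himage : N.edgeVec f A '' N.inFinset i =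
      Function.ExtendByZero.linearMap K g '' Set.range B.row := by
    rw [← Set.range_comp]
    ext v
    constructor
    · rintro ⟨e, he, rfl⟩
      exact ⟨⟨e, N.mem_inFinset.1 he⟩, hext ⟨e, N.mem_inFinset.1 he⟩⟩
    · rintro ⟨e, rfl⟩
      exact ⟨e.1, N.mem_inFinset.2 e.2, (hext e).symm⟩
  rw [Matrix.rank_eq_finrank_span_row, himage, ← Submodule.map_span]
  refine (Submodule.equivMapOfInjective _ ?_ _).finrank_eq
  intro x y hxy
  funext c
  have := congrFun hxy (g c)
  change Function.extend g x 0 (g c) = Function.extend g y 0 (g c) at this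
  rwa [hg.extend_apply, hg.extend_apply] at this

theorem rank_H (f : E → E → K) (i j : Fin 2) : (N.H f i j).rank =
    Module.finrank K (Submodule.span K (N.edgeVec f {j} '' N.inFinset i)) := by
  refine N.rank_eq_finrank_span_edgeVec f {j} i (g := Subtype.val) Subtype.val_injective ?_ _ ?_
  · rintro d ⟨j', hj', hd⟩
    rw [Finset.mem_singleton.1 hj'] at hd
    exact ⟨⟨d, hd⟩, rfl⟩
  · intro e c
    rw [edgeVec, if_pos ⟨j, Finset.mem_singleton_self j, c.2⟩]
    rfl

theorem rank_fromCols_H (f : E → E → K) (i : Fin 2) :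
    (Matrix.fromCols (N.H f i 0) (N.H f i 1)).rank =
      Module.finrank K (Submodule.span K (N.edgeVec f {0, 1} '' N.inFinset i)) := by
  refine N.rank_eq_finrank_span_edgeVec f {0, 1} i (g := Sum.elim Subtype.val Subtype.val) ?_ ?_ _ ?_
  · refine Subtype.val_injective.sumElim Subtype.val_injective fun a b hab => ?_
    have h := a.2.symm.trans ((congrArg N.tail hab).trans b.2)
    exact absurd (N.s_injective h) (by decide)
  · rintro d ⟨j, -, hd⟩
    match j with
    | 0 => exact ⟨Sum.inl ⟨d, hd⟩, rfl⟩
    | 1 => exact ⟨Sum.inr ⟨d, hd⟩, rfl⟩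
  · rintro e (c | c)
    · rw [edgeVec, if_pos ⟨0, by simp, c.2⟩]
      rfl
    · rw [edgeVec, if_pos ⟨1, by simp, c.2⟩]
      rfl

/-- Algebraic max-flow min-cut theorem for generic local coding coefficients. -/
theorem finrank_span_edgeVec_inFinset {ord : E → ℕ}
    (hord : ∀ m e, N.head m = N.tail e → ord m < ord e) (hinj : Function.Injective ord)
    {f : E → E → K} (hf : ∀ e, N.GenericAt ord f e) (A : Finset (Fin 2)) (i : Fin 2) :
    Module.finrank K (Submodule.span K (N.edgeVec f A '' N.inFinset i)) = N.k A {i} := by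
  obtain ⟨F, hF, hcard⟩ := N.exists_blocks_card_le hord hinj hf A (N.inFinset i)
  have hcut := isCut_of_blocks (fun e he => N.mem_inFinset.2 he) hF
  have hk : N.k A {i} ≤ F.card := Nat.sInf_le ⟨F, hcut, rfl⟩
  refine le_antisymm ?_ (hk.trans hcard)
  obtain ⟨F', hF', hk⟩ := Nat.sInf_mem (s := {n | ∃ F : Finset E, N.IsCut A {i} F ∧ F.card = n})
    ⟨_, F, hcut, rfl⟩
  exact (N.finrank_span_edgeVec_le f
    (blocks_of_isCut (fun e he => N.mem_inFinset.1 he) hF')).trans_eq hk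

theorem exists_hasMaxRank [Finite K]
    (hcard : Fintype.card (Finset (Fin 2) × Finset E) < Nat.card K) :
    ∃ f : E → E → K, N.HasMaxRank f := by
  obtain ⟨ord, hinj, hord⟩ := N.exists_topological_numbering
  obtain ⟨f, hf⟩ := N.exists_forall_genericAt hcard hord hinj
  exact ⟨f, fun i j => (N.rank_H f i j).trans (N.finrank_span_edgeVec_inFinset hord hinj hf _ _),
    fun i => (N.rank_fromCols_H f i).trans (N.finrank_span_edgeVec_inFinset hord hinj hf _ _)⟩

-- Both terminals constrain the greedy choice, each with a pair of subspaces; hence more than four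
-- field elements.
variable {N} in
theorem HasMaxRank.exists_isCodeAtQ₁ [Finite K] {f : E → E → K} (hf : N.HasMaxRank f)
    (hcard : 4 < Nat.card K) (hInterference : N.kMin ≤ N.k {0} {1} + N.k {1} {0})
    (hCut : N.k {0} {1} ≤ N.k {0} {0}) :
    ∃ M : ∀ i, Matrix (N.Out i) (Fin (N.rateQ₁ i)) K, N.IsCodeAtQ₁ f M := by
  have h0 := rateQ₁_zero hCut
  have h1 := hf.rateQ₁_one hInterference hCut
  have hle := hf.k_le_kMin hCut
  have h1' : N.rateQ₁ 1 ≤ min (N.k {1} {0}) (N.k {1} {1}) := min_le_left _ _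
  have hmin0 : N.kMin ≤ N.k {0, 1} {0} := min_le_left _ _
  have hmin1 : N.kMin ≤ N.k {0, 1} {1} := min_le_right _ _
  obtain ⟨M₀, M₁, hM⟩ := Matrix.exists_rank_fromCols_mul (ι := Fin 2)
    (avoidsPairs_of_card_lt (by simpa using hcard)) (avoidsPairs_of_card_lt (by simpa using hcard))
    (fun i => N.H f i 0) (fun i => N.H f i 1) (N.rateQ₁ 0) (N.rateQ₁ 1)
    (fun i => by rw [hf.single]; fin_cases i <;> simp <;> omega)
    (fun i => by rw [hf.single]; fin_cases i <;> simp <;> omega)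
    (fun i => by rw [hf.both]; fin_cases i <;> simp <;> omega)
  obtain ⟨hA, hB, -⟩ := Matrix.rank_eq_and_disjoint_of_rank_fromCols (hM 0)
  let M : ∀ i, Matrix (N.Out i) (Fin (N.rateQ₁ i)) K
    | 0 => M₀
    | 1 => M₁
  refine ⟨M, hf, fun i => ?_, hM⟩
  refine le_antisymm ((M i).rank_le_card_width.trans_eq (Fintype.card_fin _)) ?_
  match i with
  | 0 => exact hA.symm.trans_le (Matrix.rank_mul_le_right _ _)
  | 1 => exact hB.symm.trans_le (Matrix.rank_mul_le_right _ _)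

end MaxRank

end TwoUnicastNetwork

theorem mainTheorem2 {V E : Type*} [Finite V] [Fintype E] (N : TwoUnicastNetwork V E)
    (hInterference : min (N.k {0, 1} {0}) (N.k {0, 1} {1}) ≤ N.k {0} {1} + N.k {1} {0})
    (hCut : N.k {0} {1} ≤ N.k {0} {0}) :
    (∃ (K : Type) (_ : Field K) (_ : Finite K) (f : E → E → K)
      (M : ∀ i, Matrix (N.Out i) (Fin (N.rateQ₁ i)) K), N.IsCodeAtQ₁ f M) ∧
    ∀ (K : Type*) [Field K] [Finite K] (f : E → E → K)
      (M : ∀ i, Matrix (N.Out i) (Fin (N.rateQ₁ i)) K), N.IsCodeAtQ₁ f M →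
      ∀ R₁ R₂ : ℕ,
        R₁ ≤ N.k {0} {0} →
        R₂ ≤ min (N.k {0, 1} {0}) (N.k {0, 1} {1}) - N.k {0} {1} →
        R₁ + R₂ ≤ (Matrix.fromCols (N.H f 0 0) (N.H f 0 1 * M 1)).rank →
        N.Achievable K ![R₁, R₂] := by
  refine ⟨?_, fun K _ _ f M hM R₁ R₂ h₁ h₂ h₁₂ => hM.achievable hInterference hCut h₁ h₂ h₁₂⟩
  -- The `5` ensures `4 < p` for the precoding; the other summand serves the generic coefficients.
  obtain ⟨p, hp, hprime⟩ :=
    Nat.exists_infinite_primes (Fintype.card (Finset (Fin 2) × Finset E) + 5)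
  have : Fact p.Prime := ⟨hprime⟩
  obtain ⟨f, hf⟩ := N.exists_hasMaxRank (K := ZMod p) (by rw [Nat.card_zmod]; omega)
  obtain ⟨M, hM⟩ := hf.exists_isCodeAtQ₁ (by rw [Nat.card_zmod]; omega) hInterference hCut
  exact ⟨ZMod p, inferInstance, inferInstance, f, M, hM⟩
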